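/- Let $K$ be an algebraically closed field of characteristic zero, and let $G$ be a reductive group over $K$, i.e. an affine algebraic group all of whose finite-dimensional rational representations are completely reducible. Let $G$ act on an irreducible affine scheme $X=\operatorname{Spec} A$ of finite type over $K$, put $X/\!\!/G=\operatorname{Spec}(A^G)$, and let $\pi:X\to X/\!\!/G$ be the morphism given by the inclusion $A^G\subseteq A$. For a natural number $i$, a scheme $Y$ is said to have property $(S_i)$ if $$\operatorname{depth}(\mathcal{O}_{Y,Z})\ \ge\ \min(i,\operatorname{codim}_Y Z)$$ for every irreducible closed subset $Z$ of $Y$, where $\mathcal{O}_{Y,Z}$ is the local ring of $Y$ at the generic point of $Z$. The codimension of a closed subset of $Y$ is the infimum of the codimensions of the irreducible closed subsets of $Y$ that it contains; the empty set has codimension $\infty$. **Theorem.** Let $U$ be an open subscheme of $X/\!\!/G$. Suppose that $X$ and $U$ have property $(S_i)$ and that $\pi^{-1}\big((X/\!\!/G)\setminus U\big)$ has codimension at least $i$ in $X$. Then $X/\!\!/G$ has property $(S_i)$. -/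

import Mathlib

open AlgebraicGeometry TopologicalSpace
open scoped TensorProduct

universe u

/-! ## Affine algebraic groups and their rational representations

An affine algebraic group `G` over a field `K` is given by its coordinate ring `H = K[G]`, a
commutative Hopf algebra of finite type over `K`. -/

/-- A rational (left) representation on `V` of the affine algebraic group with coordinate
ring `H`, given as usual by its coaction `V → V ⊗ H`: if `v` is sent to `∑ vᵢ ⊗ hᵢ`
then `g • v = ∑ hᵢ(g) vᵢ`. -/
structure RationalRep (K H V : Type*) [Field K] [CommRing H] [HopfAlgebra K H]
    [AddCommGroup V] [Module K V] where
  /-- The coaction. -/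
  coact : V →ₗ[K] V ⊗[K] H
  /-- `g • (h • v) = (g h) • v`. -/
  coassoc : (TensorProduct.assoc K V H H).toLinearMap ∘ₗ coact.rTensor H ∘ₗ coact =
    (Coalgebra.comul (R := K) (A := H)).lTensor V ∘ₗ coact
  /-- `1 • v = v`. -/
  counit_coact : (TensorProduct.rid K V).toLinearMap ∘ₗ
    (Coalgebra.counit (R := K) (A := H)).lTensor V ∘ₗ coact = LinearMap.id

/-- A subspace `W` is a subrepresentation if the coaction sends `W` into `W ⊗ H`. -/
def RationalRep.IsSubrep {K H V : Type*} [Field K] [CommRing H] [HopfAlgebra K H]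
    [AddCommGroup V] [Module K V] (ρ : RationalRep K H V) (W : Submodule K V) : Prop :=
  ∀ w ∈ W, ρ.coact w ∈ LinearMap.range (W.subtype.rTensor H)

/-- Reductivity of the affine algebraic group with coordinate ring `H` over a field `K` of
characteristic zero: every finite-dimensional rational representation is completely reducible,
that is, every subrepresentation has a complementary subrepresentation. -/
def IsReductiveGroup (K H : Type u) [Field K] [CommRing H] [HopfAlgebra K H] : Prop :=
  ∀ (V : Type u) [AddCommGroup V] [Module K V] [FiniteDimensional K V]
    (ρ : RationalRep K H V) (W : Submodule K V), ρ.IsSubrep W →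
      ∃ W' : Submodule K V, ρ.IsSubrep W' ∧ IsCompl W W'

/-! ## Actions on affine schemes and the quotient `X // G` -/

/-- An action of the affine algebraic group `G` with coordinate ring `H` on the affine
scheme `X = Spec A`, given by the corresponding rational action of `G` on `A` by `K`-algebra
automorphisms, `(g • f)(x) = f(g⁻¹ x)`. Its coaction `A → A ⊗ H` is the homomorphism of
`K`-algebras which is dual to the morphism `X × G → X`, `(x, g) ↦ g⁻¹ x`. -/
structure AffineAction (K H A : Type*) [Field K] [CommRing H] [HopfAlgebra K H]
    [CommRing A] [Algebra K A] where
  /-- The coaction. -/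
  coact : A →ₐ[K] A ⊗[K] H
  /-- `g • (h • f) = (g h) • f`. -/
  coassoc : (TensorProduct.assoc K A H H).toLinearMap ∘ₗ coact.toLinearMap.rTensor H ∘ₗ
      coact.toLinearMap =
    (Coalgebra.comul (R := K) (A := H)).lTensor A ∘ₗ coact.toLinearMap
  /-- `1 • f = f`. -/
  counit_coact : (TensorProduct.rid K A).toLinearMap ∘ₗ
    (Coalgebra.counit (R := K) (A := H)).lTensor A ∘ₗ coact.toLinearMap = LinearMap.id

namespace AffineAction

variable {K H A : Type u} [Field K] [CommRing H] [HopfAlgebra K H] [CommRing A] [Algebra K A]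

/-- The algebra of invariants `A^G`, consisting of the `a` with coaction `a ⊗ 1`. -/
def invariants (σ : AffineAction K H A) : Subalgebra K A :=
  AlgHom.equalizer σ.coact (Algebra.TensorProduct.includeLeft : A →ₐ[K] A ⊗[K] H)

/-- The affine quotient `X // G = Spec A^G`. -/
noncomputable def quotient (σ : AffineAction K H A) : Scheme.{u} :=
  Spec (CommRingCat.of σ.invariants)

/-- The natural map `π : X → X // G`, dual to the inclusion of `A^G` in `A`. -/
noncomputable def quotientMap (σ : AffineAction K H A) : Spec (CommRingCat.of A) ⟶ σ.quotient :=
  Spec.map (CommRingCat.ofHom σ.invariants.val.toRingHom)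

end AffineAction

/-! ## Codimension, depth and the property `(S_i)` -/

/-- The codimension of a closed subset `Y` of a topological space `X`: the infimum, over the
irreducible closed subsets `Z` of `X` contained in `Y`, of the supremum `Order.coheight Z` of the
lengths of chains of irreducible closed subsets of `X` that start with `Z`. The codimension of
the empty set is `⊤`. -/
noncomputable def closedCodim {X : Type*} [TopologicalSpace X] (Y : Set X) : ℕ∞ :=
  ⨅ (Z : IrreducibleCloseds X) (_ : (Z : Set X) ⊆ Y), Order.coheight Z

/-- The depth of a local ring: the supremum of the lengths of the regular sequences in its
maximal ideal. -/
noncomputable def localRingDepth (R : Type*) [CommRing R] [IsLocalRing R] : ℕ∞ :=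
  ⨆ (rs : List R) (_ : (∀ r ∈ rs, r ∈ IsLocalRing.maximalIdeal R) ∧
    RingTheory.Sequence.IsRegular R rs), (rs.length : ℕ∞)

/-- The property `(S_i)` of a scheme `X`: for every irreducible closed subset `Z` of `X`, the
local ring `𝒪_{X,Z}` of `X` at the generic point of `Z` has depth at least
`min (i, codim_X Z)`. -/
def HasPropertyS (X : Scheme.{u}) (i : ℕ) : Prop :=
  ∀ Z : IrreducibleCloseds X,
    min (i : ℕ∞) (Order.coheight Z) ≤
      localRingDepth (X.presheaf.stalk Z.isIrreducible.genericPoint)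

/-! At points of `U` the bound is inherited from `U`, so let z lie in the complement C, with
vanishing ideal I in A^G. Every prime of A containing IA lies over C, so (S_i) for X and the
codimension bound give A depth at least i there. Prime avoidance, carried out inside I itself, turns
this local information into one weakly A-regular sequence of i invariants in I
(`exists_isWeaklyRegular_of_forall_localization`). Reductivity gives JA ∩ A^G = J for finitely
generated J (`comap_map_invariants_le`): an invariant combination of invariant generators can be
rewritten with invariant coefficients. Hence the sequence is weakly regular on A^G
(`isWeaklyRegular_of_comap_map_le`). Localized at z, which contains I, it is regular of length i.
Only A, not A^G, has to be Noetherian. -/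

/-! ### Contracting tensors with linear forms. -/

section Slices

variable {K H V W : Type*} [Field K] [CommRing H] [Algebra K H]
  [AddCommGroup V] [Module K V] [AddCommGroup W] [Module K W]

/-- Contraction of a tensor in `V ⊗ H` with a linear form on `H`. -/
noncomputable def tensorSlice (V : Type*) [AddCommGroup V] [Module K V] :
    (H →ₗ[K] K) →ₗ[K] V ⊗[K] H →ₗ[K] V :=
  (LinearMap.llcomp K _ _ _ (TensorProduct.rid K V).toLinearMap) ∘ₗ LinearMap.lTensorHom V

@[simp]
lemma tensorSlice_tmul (f : H →ₗ[K] K) (v : V) (h : H) :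
    tensorSlice V f (v ⊗ₜ h) = f h • v := by
  simp [tensorSlice]

lemma tensorSlice_rTensor (φ : V →ₗ[K] W) (f : H →ₗ[K] K) (t : V ⊗[K] H) :
    tensorSlice W f (φ.rTensor H t) = φ (tensorSlice V f t) := by
  induction t with
  | zero => simp
  | tmul v h => simp
  | add s t hs ht => simp [hs, ht]

/-- The coordinates of `t` along a basis of `H` are themselves slices. -/
lemma eq_zero_of_tensorSlice_eq_zero {t : V ⊗[K] H}
    (h : ∀ f : H →ₗ[K] K, tensorSlice V f t = 0) : t = 0 := by
  classical
  let b := Module.Basis.ofVectorSpace K H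
  have key (s : V ⊗[K] H) (i) :
      TensorProduct.equivFinsuppOfBasisRight b s i = tensorSlice V (b.coord i) s := by
    induction s with
    | zero => simp
    | tmul v h => simp
    | add s t hs ht => simp [hs, ht]
  apply (TensorProduct.equivFinsuppOfBasisRight b).injective
  ext i
  simp [key, h]

lemma mem_range_rTensor_subtype_iff (E : Submodule K V) (t : V ⊗[K] H) :
    t ∈ LinearMap.range (E.subtype.rTensor H) ↔ ∀ f : H →ₗ[K] K, tensorSlice V f t ∈ E := by
  refine ⟨?_, fun h ↦ ?_⟩
  · rintro ⟨u, rfl⟩ f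
    rw [tensorSlice_rTensor]
    exact (tensorSlice E f u).2
  · refine (rTensor_exact H (LinearMap.exact_subtype_mkQ E) E.mkQ_surjective t).mp ?_
    refine eq_zero_of_tensorSlice_eq_zero fun f ↦ ?_
    rw [tensorSlice_rTensor]
    simpa using h f

/-- A tensor is a finite sum of pure tensors. This is the source of local finiteness of rational
representations. -/
lemma exists_finiteDimensional_tensorSlice_mem (t : V ⊗[K] H) :
    ∃ E : Submodule K V, FiniteDimensional K E ∧ ∀ f : H →ₗ[K] K, tensorSlice V f t ∈ E := by
  induction t with
  | zero => exact ⟨⊥, inferInstance, by simp⟩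
  | tmul v h =>
    exact ⟨K ∙ v, inferInstance, fun f ↦ by
      simpa using Submodule.smul_mem _ _ (Submodule.mem_span_singleton_self v)⟩
  | add s t hs ht =>
    obtain ⟨E, _, hE⟩ := hs
    obtain ⟨F, _, hF⟩ := ht
    exact ⟨E ⊔ F, inferInstance, fun f ↦ by
      simpa using Submodule.add_mem_sup (hE f) (hF f)⟩

lemma rTensor_lTensor_comm {H' : Type*} [AddCommGroup H'] [Module K H'] (φ : V →ₗ[K] W)
    (δ : H →ₗ[K] H') (t : V ⊗[K] H) :
    φ.rTensor H' (δ.lTensor V t) = δ.lTensor W (φ.rTensor H t) := by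
  induction t with
  | zero => simp
  | tmul v h => simp
  | add s t hs ht => simp [hs, ht]

lemma assoc_rTensor_of_equivariant {c : V →ₗ[K] V ⊗[K] H} {d : W →ₗ[K] W ⊗[K] H} {φ : V →ₗ[K] W}
    (hφ : φ.rTensor H ∘ₗ c = d ∘ₗ φ) (t : V ⊗[K] H) :
    φ.rTensor (H ⊗[K] H) (TensorProduct.assoc K V H H (c.rTensor H t)) =
      TensorProduct.assoc K W H H (d.rTensor H (φ.rTensor H t)) := by
  have key (s : V ⊗[K] H) (h : H) :
      φ.rTensor (H ⊗[K] H) (TensorProduct.assoc K V H H (s ⊗ₜ h)) =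
        TensorProduct.assoc K W H H (φ.rTensor H s ⊗ₜ h) := by
    induction s with
    | zero => simp
    | tmul w h' => simp
    | add s t hs ht => simp [TensorProduct.add_tmul, hs, ht]
  induction t with
  | zero => simp
  | tmul v h => simpa [key] using congrArg (· ⊗ₜ[K] h) (LinearMap.congr_fun hφ v)
  | add s t hs ht => simp [hs, ht]

end Slices

/-! ### Cyclic subrepresentations and finite powers. -/

namespace RationalRep

variable {K H V W : Type*} [Field K] [CommRing H] [HopfAlgebra K H]
  [AddCommGroup V] [Module K V] [AddCommGroup W] [Module K W]

/-- Slicing the coaction makes the dual of `H`, under convolution, act on `V`; this is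
coassociativity. It makes `cyclic` stable. -/
lemma tensorSlice_coact_tensorSlice_coact (ρ : RationalRep K H V) (g f : H →ₗ[K] K) (v : V) :
    tensorSlice V g (ρ.coact (tensorSlice V f (ρ.coact v))) =
      tensorSlice V ((LinearMap.mul' K K ∘ₗ TensorProduct.map g f) ∘ₗ
        Coalgebra.comul (R := K) (A := H)) (ρ.coact v) := by
  let T : V ⊗[K] (H ⊗[K] H) →ₗ[K] V := (TensorProduct.rid K V).toLinearMap ∘ₗ
    (LinearMap.mul' K K ∘ₗ TensorProduct.map g f).lTensor V
  have h₁ (t : V ⊗[K] H) : T (TensorProduct.assoc K V H H (ρ.coact.rTensor H t)) =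
      tensorSlice V g (ρ.coact (tensorSlice V f t)) := by
    induction t with
    | zero => simp
    | tmul v h =>
      have (s : V ⊗[K] H) : T (TensorProduct.assoc K V H H (s ⊗ₜ h)) =
          f h • tensorSlice V g s := by
        induction s with
        | zero => simp
        | tmul w h' => simp [T, mul_smul, smul_comm (f h)]
        | add s t hs ht => simp [TensorProduct.add_tmul, hs, ht]
      simp [this]
    | add s t hs ht => simp [hs, ht]
  have h₂ (t : V ⊗[K] H) : T ((Coalgebra.comul (R := K) (A := H)).lTensor V t) =
      tensorSlice V ((LinearMap.mul' K K ∘ₗ TensorProduct.map g f) ∘ₗ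
        Coalgebra.comul (R := K) (A := H)) t := by
    induction t with
    | zero => simp
    | tmul v h => simp [T]
    | add s t hs ht => simp [hs, ht]
  rw [← h₁, ← h₂]
  exact congrArg T (LinearMap.congr_fun ρ.coassoc v)

/-- The subrepresentation generated by a vector. -/
noncomputable def cyclic (ρ : RationalRep K H V) (v : V) : Submodule K V :=
  LinearMap.range ((tensorSlice V).flip (ρ.coact v) : (H →ₗ[K] K) →ₗ[K] V)

lemma isSubrep_iff (ρ : RationalRep K H V) (E : Submodule K V) :
    ρ.IsSubrep E ↔ ∀ w ∈ E, ∀ f : H →ₗ[K] K, tensorSlice V f (ρ.coact w) ∈ E := by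
  simp only [IsSubrep, mem_range_rTensor_subtype_iff]

lemma isSubrep_cyclic (ρ : RationalRep K H V) (v : V) : ρ.IsSubrep (ρ.cyclic v) := by
  rw [isSubrep_iff]
  rintro _ ⟨f, rfl⟩ g
  exact ⟨_, (ρ.tensorSlice_coact_tensorSlice_coact g f v).symm⟩

lemma mem_cyclic (ρ : RationalRep K H V) (v : V) : v ∈ ρ.cyclic v :=
  ⟨Coalgebra.counit, LinearMap.congr_fun ρ.counit_coact v⟩

instance finiteDimensional_cyclic (ρ : RationalRep K H V) (v : V) :
    FiniteDimensional K (ρ.cyclic v) := by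
  obtain ⟨E, _, hE⟩ := exists_finiteDimensional_tensorSlice_mem (ρ.coact v)
  refine Submodule.finiteDimensional_of_le (S₂ := E) ?_
  rintro _ ⟨f, rfl⟩
  exact hE f

/-- The coaction of a subrepresentation. -/
noncomputable def restrictCoact (ρ : RationalRep K H V) (E : Submodule K V) (hE : ρ.IsSubrep E) :
    E →ₗ[K] E ⊗[K] H :=
  (LinearEquiv.ofInjective (E.subtype.rTensor H)
    (Module.Flat.rTensor_preserves_injective_linearMap _ E.injective_subtype)).symm.toLinearMap ∘ₗ
    (ρ.coact ∘ₗ E.subtype).codRestrict _ fun w ↦ hE w w.2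

lemma rTensor_subtype_restrictCoact (ρ : RationalRep K H V) (E : Submodule K V)
    (hE : ρ.IsSubrep E) (w : E) :
    E.subtype.rTensor H (ρ.restrictCoact E hE w) = ρ.coact w := by
  exact congrArg Subtype.val (LinearEquiv.apply_symm_apply
    (LinearEquiv.ofInjective (E.subtype.rTensor H)
      (Module.Flat.rTensor_preserves_injective_linearMap _ E.injective_subtype))
    ((ρ.coact ∘ₗ E.subtype).codRestrict _ (fun w ↦ hE w w.2) w))

/-- A subrepresentation as a representation. -/
noncomputable def restrict (ρ : RationalRep K H V) (E : Submodule K V) (hE : ρ.IsSubrep E) :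
    RationalRep K H E where
  coact := ρ.restrictCoact E hE
  coassoc := by
    ext w
    -- Over a field `H ⊗ H` is flat, so the identity may be checked inside `V ⊗ (H ⊗ H)`.
    apply Module.Flat.rTensor_preserves_injective_linearMap (M := H ⊗[K] H) _ E.injective_subtype
    have h := assoc_rTensor_of_equivariant (φ := E.subtype)
      (LinearMap.ext (rTensor_subtype_restrictCoact ρ E hE)) (ρ.restrictCoact E hE w)
    simpa [h, rTensor_lTensor_comm, rTensor_subtype_restrictCoact] using
      LinearMap.congr_fun ρ.coassoc w
  counit_coact := by
    ext w
    have h := LinearMap.congr_fun ρ.counit_coact (w : V)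
    rw [LinearMap.comp_apply, LinearMap.comp_apply, ← rTensor_subtype_restrictCoact ρ E hE] at h
    exact (tensorSlice_rTensor E.subtype (Coalgebra.counit (R := K) (A := H)) _).symm.trans h

/-- The coaction of a finite direct power. -/
noncomputable def piCoact (ρ : RationalRep K H V) (ι : Type*) [Fintype ι] [DecidableEq ι] :
    (ι → V) →ₗ[K] (ι → V) ⊗[K] H :=
  ∑ j, (LinearMap.single K (fun _ : ι ↦ V) j).rTensor H ∘ₗ ρ.coact ∘ₗ LinearMap.proj j

lemma rTensor_single_comp_coact (ρ : RationalRep K H V) (ι : Type*) [Fintype ι] [DecidableEq ι]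
    (j : ι) : (LinearMap.single K (fun _ : ι ↦ V) j).rTensor H ∘ₗ ρ.coact =
      ρ.piCoact ι ∘ₗ LinearMap.single K (fun _ : ι ↦ V) j := by
  ext v
  simp only [piCoact, LinearMap.comp_apply, LinearMap.sum_apply, LinearMap.proj_apply,
    LinearMap.single_apply]
  rw [Finset.sum_eq_single j (fun k _ hk ↦ by simp [hk]) (by simp)]
  simp

lemma piCoact_single (ρ : RationalRep K H V) (ι : Type*) [Fintype ι] [DecidableEq ι]
    (j : ι) (v : V) : ρ.piCoact ι (Pi.single j v) =
      (LinearMap.single K (fun _ : ι ↦ V) j).rTensor H (ρ.coact v) :=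
  (LinearMap.congr_fun (ρ.rTensor_single_comp_coact ι j) v).symm

/-- Finite direct powers of a representation. -/
noncomputable def pi (ρ : RationalRep K H V) (ι : Type*) [Fintype ι] [DecidableEq ι] :
    RationalRep K H (ι → V) where
  coact := ρ.piCoact ι
  coassoc := by
    refine LinearMap.pi_ext fun j v ↦ ?_
    have h := assoc_rTensor_of_equivariant (ρ.rTensor_single_comp_coact ι j) (ρ.coact v)
    have h' := congrArg ((LinearMap.single K (fun _ : ι ↦ V) j).rTensor (H ⊗[K] H))
      (LinearMap.congr_fun ρ.coassoc v)
    simp only [LinearMap.comp_apply, LinearEquiv.coe_coe] at h' ⊢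
    rw [piCoact_single, ← h, h', rTensor_lTensor_comm]
  counit_coact := by
    refine LinearMap.pi_ext fun j v ↦ ?_
    have h := LinearMap.congr_fun ρ.counit_coact v
    simp only [LinearMap.comp_apply, LinearMap.id_apply] at h ⊢
    rw [piCoact_single]
    refine (tensorSlice_rTensor (LinearMap.single K (fun _ : ι ↦ V) j)
      (Coalgebra.counit (R := K) (A := H)) _).trans ?_
    exact congrArg (Pi.single j) h

lemma rTensor_proj_piCoact (ρ : RationalRep K H V) (ι : Type*) [Fintype ι] [DecidableEq ι]
    (j : ι) (s : ι → V) :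
    (LinearMap.proj j : (ι → V) →ₗ[K] V).rTensor H (ρ.piCoact ι s) = ρ.coact (s j) := by
  suffices (LinearMap.proj j : (ι → V) →ₗ[K] V).rTensor H ∘ₗ ρ.piCoact ι =
      ρ.coact ∘ₗ LinearMap.proj j from LinearMap.congr_fun this s
  refine LinearMap.pi_ext fun k v ↦ ?_
  simp only [LinearMap.comp_apply, piCoact_single, LinearMap.proj_apply]
  rw [← LinearMap.comp_apply, ← LinearMap.rTensor_comp]
  by_cases hkj : k = j
  · subst hkj
    simp [LinearMap.proj_comp_single_same]
  · simp [LinearMap.proj_comp_single_ne K _ j k (Ne.symm hkj), Pi.single_eq_of_ne (Ne.symm hkj)]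

end RationalRep

/-! ### Lifting invariants and contracting extended ideals. -/

section Reductive

variable {K H : Type u} [Field K] [CommRing H] [HopfAlgebra K H]

/-- For a reductive group, invariant vectors lift along equivariant surjections. -/
lemma IsReductiveGroup.exists_invariant_lift (hG : IsReductiveGroup K H) {V W : Type u}
    [AddCommGroup V] [Module K V] [AddCommGroup W] [Module K W] (ρ : RationalRep K H V)
    (d : W →ₗ[K] W ⊗[K] H) (φ : V →ₗ[K] W) (hφ : φ.rTensor H ∘ₗ ρ.coact = d ∘ₗ φ) (v : V)
    (hv : d (φ v) = φ v ⊗ₜ 1) : ∃ v', φ v' = φ v ∧ ρ.coact v' = v' ⊗ₜ 1 := by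
  -- Complete reducibility is available only in finite dimension, hence the restriction to the
  -- subrepresentation generated by `v`.
  have hE := ρ.isSubrep_cyclic v
  let ρE := ρ.restrict _ hE
  let ψ := φ ∘ₗ (ρ.cyclic v).subtype
  have hψ (w : ρ.cyclic v) : ψ.rTensor H (ρE.coact w) = d (ψ w) := by
    rw [LinearMap.rTensor_comp, LinearMap.comp_apply]
    exact (congrArg _ (ρ.rTensor_subtype_restrictCoact _ hE w)).trans
      (LinearMap.congr_fun hφ (w : V))
  have hN : ρE.IsSubrep (LinearMap.ker ψ) := by
    rw [RationalRep.isSubrep_iff]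
    intro w hw f
    rw [LinearMap.mem_ker, ← tensorSlice_rTensor, hψ, LinearMap.mem_ker.mp hw, map_zero, map_zero]
  obtain ⟨L, hL, hcompl⟩ := hG _ ρE _ hN
  obtain ⟨n, hn, l, hl, hnl⟩ := Submodule.mem_sup.mp
    (hcompl.sup_eq_top ▸ Submodule.mem_top : (⟨v, ρ.mem_cyclic v⟩ : ρ.cyclic v) ∈ _)
  have hψl : ψ l = φ v := by
    have := congrArg ψ hnl
    rwa [map_add, LinearMap.mem_ker.mp hn, zero_add] at this
  -- The slices of `ρE.coact l - l ⊗ₜ 1` lie in `L` by stability and in the kernel because `ψ l` is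
  -- invariant; these meet in zero.
  have hl1 : ρE.coact l = l ⊗ₜ 1 := by
    refine sub_eq_zero.mp (eq_zero_of_tensorSlice_eq_zero fun f ↦ ?_)
    refine (Submodule.mem_bot K).mp (hcompl.inf_eq_bot ▸ Submodule.mem_inf.mpr ⟨?_, ?_⟩)
    · rw [LinearMap.mem_ker, ← tensorSlice_rTensor, map_sub, hψ, LinearMap.rTensor_tmul, hψl, hv,
        sub_self, map_zero]
    · rw [map_sub, tensorSlice_tmul]
      exact sub_mem ((ρE.isSubrep_iff L).mp hL l hl f) (L.smul_mem _ hl)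
  exact ⟨l, hψl, by
    rw [← ρ.rTensor_subtype_restrictCoact _ hE]
    exact (congrArg _ hl1).trans (by simp)⟩

namespace AffineAction

variable {A : Type u} [CommRing A] [Algebra K A]

/-- The representation on the coordinate ring. -/
def toRationalRep (σ : AffineAction K H A) : RationalRep K H A where
  coact := σ.coact.toLinearMap
  coassoc := σ.coassoc
  counit_coact := σ.counit_coact

/-- Extending an ideal from the ring of invariants of a reductive group and contracting it back
gives the same ideal. -/
lemma comap_map_invariants_le (hG : IsReductiveGroup K H) (σ : AffineAction K H A)
    (J : Ideal σ.invariants) (hJ : J.FG) :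
    (J.map (algebraMap σ.invariants A)).comap (algebraMap σ.invariants A) ≤ J := by
  classical
  obtain ⟨m, x, rfl⟩ := Submodule.fg_iff_exists_fin_generating_family.mp hJ
  intro r hr
  rw [Ideal.mem_comap, ← Ideal.span, Ideal.map_span, ← Set.range_comp, Ideal.span,
    Submodule.mem_span_range_iff_exists_fun] at hr
  obtain ⟨c, hc⟩ := hr
  -- The map `c ↦ ∑ c j * x j` is equivariant because the generators are invariant.
  let φ : (Fin m → A) →ₗ[K] A := ∑ j, LinearMap.mulRight K (x j : A) ∘ₗ LinearMap.proj j
  have hφs (j : Fin m) :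
      φ ∘ₗ LinearMap.single K (fun _ ↦ A) j = LinearMap.mulRight K (x j : A) := by
    ext a
    simp only [φ, LinearMap.comp_apply, LinearMap.sum_apply]
    rw [Finset.sum_eq_single j (fun k _ hk ↦ by simp [hk]) (by simp)]
    simp
  have hinv (b : σ.invariants) : σ.coact b = (b : A) ⊗ₜ 1 := b.2
  have hφ : φ.rTensor H ∘ₗ (σ.toRationalRep.pi (Fin m)).coact = σ.coact.toLinearMap ∘ₗ φ := by
    refine LinearMap.pi_ext fun j a ↦ ?_
    have h₁ : φ (Pi.single j a) = a * x j := LinearMap.congr_fun (hφs j) a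
    have h₂ (t : A ⊗[K] H) : (LinearMap.mulRight K (x j : A)).rTensor H t =
        t * ((x j : A) ⊗ₜ 1) := by
      induction t with
      | zero => simp
      | tmul v h => simp
      | add s t hs ht => simp [hs, ht, add_mul]
    rw [LinearMap.comp_apply, LinearMap.comp_apply, h₁]
    refine (congrArg _ (σ.toRationalRep.piCoact_single (Fin m) j a)).trans ?_
    rw [← LinearMap.comp_apply, ← LinearMap.rTensor_comp, hφs, h₂, AlgHom.toLinearMap_apply,
      map_mul, hinv]
    rfl
  have hφc : φ c = r := by
    rw [show (r : A) = algebraMap σ.invariants A r from rfl, ← hc]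
    simp [φ]
  obtain ⟨s, hs, hs1⟩ := hG.exists_invariant_lift (σ.toRationalRep.pi (Fin m)) _ φ hφ c
    (by rw [hφc]; exact hinv r)
  have hsj (j : Fin m) : s j ∈ σ.invariants := by
    have := congrArg ((LinearMap.proj j : (Fin m → A) →ₗ[K] A).rTensor H) hs1
    exact (σ.toRationalRep.rTensor_proj_piCoact (Fin m) j s).symm.trans this
  refine (Submodule.mem_span_range_iff_exists_fun _).mpr ⟨fun j ↦ ⟨s j, hsj j⟩, ?_⟩
  apply Subtype.val_injective
  rw [← hφc, ← hs]
  simp [φ]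

end AffineAction

end Reductive

/-! ### Grade, prime avoidance and descent of regularity. -/

section RegularSequences

open RingTheory.Sequence CategoryTheory Abelian Limits Pointwise IsSMulRegular ModuleCat

lemma smul_top_quotSMulTop_lt_top {S M : Type*} [CommRing S] [AddCommGroup M]
    [Module S M] {I : Ideal S} {x : S} (hx : x ∈ I) (h : I • (⊤ : Submodule S M) < ⊤) :
    I • (⊤ : Submodule S (QuotSMulTop x M)) < ⊤ := by
  refine lt_top_iff_ne_top.mpr fun eq ↦ h.ne ?_
  have := congrArg (Submodule.comap (Submodule.mkQ _)) eq
  simpa [Submodule.comap_smul_top_of_surjective I _ (Submodule.mkQ_surjective _),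
    Submodule.smul_mono_left ((Ideal.span_singleton_le_iff_mem I).mpr hx),
    ← Submodule.ideal_span_singleton_smul] using this

/-- Dividing by a regular element lowers the grade by at most one. -/
lemma exists_isRegular_quotSMulTop {S M : Type u} [CommRing S] [IsNoetherianRing S]
    [AddCommGroup M] [Module S M] [Module.Finite S M] {I : Ideal S}
    (hI : I • (⊤ : Submodule S M) < ⊤) {x : S} (hxI : x ∈ I) (hx : IsSMulRegular M x)
    {rs : List S} (hrs : ∀ r ∈ rs, r ∈ I) (reg : IsRegular M rs) {n : ℕ}
    (hn : rs.length = n + 1) :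
    ∃ ss : List S, ss.length = n ∧ (∀ s ∈ ss, s ∈ I) ∧ IsRegular (QuotSMulTop x M) ss := by
  -- Rees: regular sequences in `I` are detected by vanishing of Ext from `S ⧸ I`. The long exact
  -- sequence for multiplication by `x` costs one degree.
  have ext : ∀ j < n + 1, Subsingleton (Ext (ModuleCat.of S (Shrink.{u} (S ⧸ I)))
      (ModuleCat.of S M) j) :=
    ((exists_isRegular_tfae I (n + 1) (ModuleCat.of S M) hI).out 3 1).mp (by
      exact ⟨rs, hn, hrs, reg⟩)
  refine ((exists_isRegular_tfae I n (ModuleCat.of S (QuotSMulTop x M))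
    (smul_top_quotSMulTop_lt_top hxI hI)).out 1 3).mp fun j hj ↦ ?_
  have zero₁ := AddCommGrpCat.isZero_of_iff_subsingleton.mpr (ext j (by omega))
  have zero₂ := AddCommGrpCat.isZero_of_iff_subsingleton.mpr (ext (j + 1) (by omega))
  have hx' : IsSMulRegular (ModuleCat.of S M) x := hx
  exact AddCommGrpCat.subsingleton_of_isZero <| ShortComplex.Exact.isZero_of_both_zeros
    ((Ext.covariant_sequence_exact₃' _ hx'.smulShortComplex_shortExact) j (j + 1) rfl)
    (zero₁.eq_zero_of_src _) (zero₂.eq_zero_of_tgt _)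

/-- If a regular sequence of length `n` on `M` exists locally at all primes over `I S`, then
there is a weakly regular one globally, with entries in the image of the ideal `I` of `R`. -/
lemma exists_isWeaklyRegular_of_forall_localization {R S : Type u} [CommRing R] [CommRing S]
    [Algebra R S] [IsNoetherianRing S] (I : Ideal R) (n : ℕ) (M : Type u) [AddCommGroup M]
    [Module S M] [Module.Finite S M]
    (h : ∀ (q : Ideal S) [q.IsPrime], I.map (algebraMap R S) ≤ q →
      ∃ rs : List (Localization.AtPrime q), rs.length = n ∧
        (∀ r ∈ rs, r ∈ IsLocalRing.maximalIdeal (Localization.AtPrime q)) ∧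
        IsRegular (Localization.AtPrime q ⊗[S] M) rs) :
    ∃ rs : List R, rs.length = n ∧ (∀ r ∈ rs, r ∈ I) ∧
      IsWeaklyRegular M (rs.map (algebraMap R S)) := by
  induction n generalizing M with
  | zero => exact ⟨[], by simp⟩
  | succ n ih =>
    obtain ⟨x, hxI, hx⟩ : ∃ x ∈ I, IsSMulRegular M (algebraMap R S x) := by
      -- Otherwise `I` consists of zero divisors on `M`, hence lies in the contraction of one
      -- associated prime `q`; then the localization at `q` has depth zero.
      by_contra! hI
      have hsub : (I : Set R) ⊆ ⋃ q ∈ associatedPrimes S M,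
          (q.comap (algebraMap R S) : Ideal R) := fun x hx ↦ by
        have h0 := hI x hx
        rw [isSMulRegular_iff_right_eq_zero_of_smul] at h0
        push Not at h0
        obtain ⟨m, hm, hm0⟩ := h0
        have : algebraMap R S x ∈ ⋃ p ∈ associatedPrimes S M, (p : Set S) := by
          rw [biUnion_associatedPrimes_eq_zero_divisors]
          exact ⟨m, hm0, hm⟩
        simpa using this
      -- The two `⊥` are dummies for the non-prime exceptions that prime avoidance permits.
      rw [Ideal.subset_union_prime_finite (associatedPrimes.finite S M) ⊥ ⊥
        (fun q hq _ _ ↦ have := hq.isPrime; inferInstance)] at hsub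
      obtain ⟨q, hq, hIq⟩ := hsub
      have hqp := hq.isPrime
      obtain ⟨rs, hlen, hmem, reg⟩ := h q (Ideal.map_le_iff_le_comap.mpr hIq)
      have : IsLocalizedModule q.primeCompl (TensorProduct.mk S (Localization.AtPrime q) M 1) :=
        (isLocalizedModule_iff_isBaseChange q.primeCompl (Localization.AtPrime q) _).mpr
          (TensorProduct.isBaseChange S M (Localization.AtPrime q))
      have hass : IsLocalRing.maximalIdeal (Localization.AtPrime q) ∈
          associatedPrimes (Localization.AtPrime q) (Localization.AtPrime q ⊗[S] M) := by
        apply Module.associatedPrimes.mem_associatedPrimes_of_comap_mem_associatedPrimes_of_isLocalizedModule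
          q.primeCompl (TensorProduct.mk S (Localization.AtPrime q) M 1)
        simpa [Localization.AtPrime.under_maximalIdeal] using hq
      match rs, hlen with
      | r :: rs, _ =>
        have hr : r ∈ ⋃ p ∈ associatedPrimes (Localization.AtPrime q)
            (Localization.AtPrime q ⊗[S] M), (p : Set (Localization.AtPrime q)) :=
          Set.mem_biUnion hass (hmem r (by simp))
        rw [biUnion_associatedPrimes_eq_zero_divisors] at hr
        obtain ⟨m, hm, hm0⟩ := hr
        have := ((isRegular_cons_iff _ _ _).mp reg).1
        exact hm (this.right_eq_zero_of_smul hm0)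
    obtain ⟨rs, hlen, hmem, reg⟩ := ih (QuotSMulTop (algebraMap R S x) M) fun q _ hq ↦ by
      obtain ⟨rs, hlen, hmem, reg⟩ := h q hq
      have hnt := reg.nontrivial
      have hxq : algebraMap S (Localization.AtPrime q) (algebraMap R S x) ∈
          IsLocalRing.maximalIdeal (Localization.AtPrime q) :=
        (IsLocalization.AtPrime.to_map_mem_maximal_iff _ q _).mpr
          (hq (Ideal.mem_map_of_mem _ hxI))
      obtain ⟨ss, hss, hsm, hreg⟩ := exists_isRegular_quotSMulTop
        (M := Localization.AtPrime q ⊗[S] M)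
        (lt_top_iff_ne_top.mpr (Ne.symm (Submodule.top_ne_ideal_smul_of_le_jacobson_annihilator
          (IsLocalRing.maximalIdeal_le_jacobson _)))) hxq
        (hx.of_flat_of_isBaseChange (TensorProduct.isBaseChange S M (Localization.AtPrime q)))
        hmem reg hlen
      exact ⟨ss, hss, hsm, ((QuotSMulTop.algebraMapTensorEquivTensorQuotSMulTop
        (algebraMap R S x) M (Localization.AtPrime q)).isRegular_congr ss).mp hreg⟩
    exact ⟨x :: rs, by simp [hlen], by simpa [hxI] using hmem, by simpa using ⟨hx, reg⟩⟩

/-- Weak regularity descends along a ring extension in which contracting extended finitely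
generated ideals changes nothing. -/
lemma isWeaklyRegular_of_comap_map_le {R S : Type*} [CommRing R] [CommRing S] [Algebra R S]
    (hpure : ∀ J : Ideal R, J.FG → (J.map (algebraMap R S)).comap (algebraMap R S) ≤ J)
    {rs : List R} (reg : IsWeaklyRegular S (rs.map (algebraMap R S))) :
    IsWeaklyRegular R rs := by
  rw [isWeaklyRegular_iff] at reg ⊢
  intro k hk
  have := reg k (by simpa using hk)
  rw [isSMulRegular_quotient_iff_mem_of_smul_mem] at this ⊢
  intro a ha
  simp only [← List.map_take, ← Ideal.map_ofList, List.getElem_map, smul_eq_mul,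
    Ideal.mul_top] at this ha ⊢
  -- Regularity over `S` puts the image of `a` in the extended ideal; contraction brings `a` back.
  refine hpure _ ?_ (this _ (by simpa using Ideal.mem_map_of_mem (algebraMap R S) ha))
  exact Submodule.fg_span (List.finite_toSet _)

end RegularSequences

/-! ### Depth of local rings and stalks. -/

section Depth

open RingTheory.Sequence

lemma natCast_le_localRingDepth_iff {R : Type*} [CommRing R] [IsLocalRing R] {n : ℕ} :
    (n : ℕ∞) ≤ localRingDepth R ↔ ∃ rs : List R, rs.length = n ∧
      (∀ r ∈ rs, r ∈ IsLocalRing.maximalIdeal R) ∧ IsRegular R rs := by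
  refine ⟨fun h ↦ ?_, fun ⟨rs, hlen, hmem, reg⟩ ↦ ?_⟩
  · cases n with
    | zero => exact ⟨[], by simp, by simp, IsRegular.nil R R⟩
    | succ n =>
      -- A strict bound below a supremum yields a sequence of length at least `n + 1`, which is then
      -- truncated.
      have hlt : (n : ℕ∞) < localRingDepth R := lt_of_lt_of_le (by exact_mod_cast n.lt_succ_self) h
      simp only [localRingDepth, lt_iSup_iff, Nat.cast_lt] at hlt
      obtain ⟨rs, ⟨hmem, reg⟩, hlen⟩ := hlt
      have hmem' : ∀ r ∈ rs.take (n + 1), r ∈ IsLocalRing.maximalIdeal R :=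
        fun r hr ↦ hmem r (List.mem_of_mem_take hr)
      have reg' := reg.toIsWeaklyRegular
      rw [← List.take_append_drop (n + 1) rs, isWeaklyRegular_append_iff] at reg'
      exact ⟨rs.take (n + 1), by simpa using hlen, hmem',
        .of_isWeaklyRegular_of_mem_maximalIdeal R hmem' reg'.1⟩
  · rw [← hlen]
    exact le_iSup₂_of_le rs ⟨hmem, reg⟩ le_rfl

lemma localRingDepth_le_of_ringEquiv {R S : Type*} [CommRing R] [IsLocalRing R] [CommRing S]
    [IsLocalRing S] (e : R ≃+* S) : localRingDepth R ≤ localRingDepth S := by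
  refine iSup₂_le fun rs ⟨hmem, reg⟩ ↦ le_iSup₂_of_le (rs.map e) ⟨?_, ?_⟩ (by simp)
  · intro s hs
    obtain ⟨r, hr, rfl⟩ := List.mem_map.mp hs
    have := hmem r hr
    rw [IsLocalRing.mem_maximalIdeal, mem_nonunits_iff] at this ⊢
    rwa [MulEquiv.isUnit_map e]
  · exact (e.toAddEquiv.isRegular_congr <| List.forall₂_map_right_iff.mpr <|
      List.forall₂_same.mpr fun r _ x ↦ map_mul e r x).mp reg

lemma localRingDepth_eq_of_ringEquiv {R S : Type*} [CommRing R] [IsLocalRing R] [CommRing S]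
    [IsLocalRing S] (e : R ≃+* S) : localRingDepth R = localRingDepth S :=
  le_antisymm (localRingDepth_le_of_ringEquiv e) (localRingDepth_le_of_ringEquiv e.symm)

lemma localRingDepth_stalk_congr {X : Scheme.{u}} {x y : X} (h : x = y) :
    localRingDepth (X.presheaf.stalk x) = localRingDepth (X.presheaf.stalk y) := by
  subst h
  rfl

lemma localRingDepth_stalk_spec {R : Type u} [CommRing R] (x : Spec (CommRingCat.of R))
    (p : Ideal R) [hp : p.IsPrime] (hx : x = (⟨p, hp⟩ : PrimeSpectrum R)) :
    localRingDepth ((Spec (CommRingCat.of R)).presheaf.stalk x) =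
      localRingDepth (Localization.AtPrime p) := by
  refine localRingDepth_eq_of_ringEquiv ?_
  subst hx
  exact (Spec.stalkIso (CommRingCat.of R) ⟨p, hp⟩).commRingCatIsoToRingEquiv

end Depth

/-! ### Restriction to an open subscheme. -/

section OpenSubscheme

/-- Passing to an open subset does not lower the codimension of the irreducible closed subsets
which meet it. -/
lemma coheight_le_coheight_of_isOpenEmbedding {X Y : Type*} [TopologicalSpace X]
    [TopologicalSpace Y] {f : Y → X} (hf : Topology.IsOpenEmbedding f) (Z : IrreducibleCloseds X)
    (hZ : (f ⁻¹' (Z : Set X)).Nonempty) :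
    Order.coheight Z ≤
      Order.coheight ((IrreducibleCloseds.orderIsoOfIsOpenEmbedding f hf).symm ⟨Z, hZ⟩) := by
  rw [Order.coheight_orderIso]
  refine Order.coheight_le fun p hp ↦ ?_
  -- Every member of a chain starting at `Z` contains `Z`, so it meets the open subset too.
  let p' : LTSeries {V : IrreducibleCloseds X | (f ⁻¹' (V : Set X)).Nonempty} :=
    { length := p.length
      toFun := fun j ↦ ⟨p j, hZ.mono <| Set.preimage_mono <|
        hp ▸ (p.monotone (Fin.zero_le j) : p.head ≤ p j)⟩
      step := fun j ↦ p.step j }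
  exact Order.length_le_coheight (p := p') (Subtype.coe_le_coe.mp hp.ge)

lemma HasPropertyS.min_le_localRingDepth_of_mem {X : Scheme.{u}} {U : X.Opens} {i : ℕ}
    (hU : HasPropertyS (U : Scheme.{u}) i) (Z : IrreducibleCloseds X)
    (hz : Z.isIrreducible.genericPoint ∈ U) :
    min (i : ℕ∞) (Order.coheight Z) ≤
      localRingDepth (X.presheaf.stalk Z.isIrreducible.genericPoint) := by
  have hf : Topology.IsOpenEmbedding U.ι := U.ι.isOpenEmbedding
  have hZcl : closure {Z.isIrreducible.genericPoint} = (Z : Set X) := by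
    rw [Z.isIrreducible.genericPoint_closure_eq, Z.isClosed.closure_eq]
  let x : (U : Scheme.{u}) := ⟨Z.isIrreducible.genericPoint, hz⟩
  have hx : U.ι x = Z.isIrreducible.genericPoint := rfl
  have hxZ : (U.ι ⁻¹' (Z : Set X)).Nonempty :=
    ⟨x, hZcl.subset (subset_closure (Set.mem_singleton _))⟩
  let Z' : IrreducibleCloseds (U : Scheme.{u}) :=
    (IrreducibleCloseds.orderIsoOfIsOpenEmbedding U.ι hf).symm ⟨Z, hxZ⟩
  have hgen : Z'.isIrreducible.genericPoint = x := by
    have h₁ := Z'.isIrreducible.isGenericPoint_genericPoint_closure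
    rw [Z'.isClosed.closure_eq] at h₁
    refine h₁.eq ?_
    rw [isGenericPoint_def, hf.toIsInducing.closure_eq_preimage_closure_image, Set.image_singleton,
      hx, hZcl]
    rfl
  have key : localRingDepth ((U : Scheme.{u}).presheaf.stalk x) =
      localRingDepth (X.presheaf.stalk Z.isIrreducible.genericPoint) :=
    localRingDepth_eq_of_ringEquiv (U.stalkIso x).commRingCatIsoToRingEquiv
  rw [← key, ← localRingDepth_stalk_congr hgen]
  exact (min_le_min_left _ (coheight_le_coheight_of_isOpenEmbedding hf Z hxZ)).trans (hU Z')

end OpenSubscheme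

/-- On a scheme with property `(S_i)`, the local rings at the points of a closed subset of
codimension at least `i` have depth at least `i`. -/
lemma HasPropertyS.le_localRingDepth_of_le_closedCodim {X : Scheme.{u}} {i : ℕ}
    (hX : HasPropertyS X i) {Y : Set X} (hY : IsClosed Y) (hcodim : (i : ℕ∞) ≤ closedCodim Y)
    {x : X} (hx : x ∈ Y) : (i : ℕ∞) ≤ localRingDepth (X.presheaf.stalk x) := by
  let Z : IrreducibleCloseds X := ⟨closure {x}, isIrreducible_singleton.closure, isClosed_closure⟩
  have hgen : Z.isIrreducible.genericPoint = x := by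
    have h₁ := Z.isIrreducible.isGenericPoint_genericPoint_closure
    rw [Z.isClosed.closure_eq] at h₁
    exact h₁.eq isGenericPoint_closure
  have hZ : (i : ℕ∞) ≤ Order.coheight Z :=
    hcodim.trans (iInf₂_le Z (hY.closure_subset_iff.mpr (Set.singleton_subset_iff.mpr hx)))
  have := hX Z
  rwa [min_eq_left hZ, localRingDepth_stalk_congr hgen] at this

theorem theorem7p1 {K H A : Type u} [Field K] [IsAlgClosed K] [CharZero K]
    [CommRing H] [HopfAlgebra K H] [Algebra.FiniteType K H] (hG : IsReductiveGroup K H)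
    [CommRing A] [Algebra K A] [Algebra.FiniteType K A]
    [IrreducibleSpace (Spec (CommRingCat.of A))]
    (σ : AffineAction K H A) (i : ℕ) (U : σ.quotient.Opens)
    (hX : HasPropertyS (Spec (CommRingCat.of A)) i)
    (hU : HasPropertyS (U : Scheme.{u}) i)
    (hcodim : (i : ℕ∞) ≤ closedCodim (σ.quotientMap ⁻¹' (U : Set σ.quotient)ᶜ)) :
    HasPropertyS σ.quotient i := by
  intro Z
  by_cases hz : Z.isIrreducible.genericPoint ∈ U
  · exact hU.min_le_localRingDepth_of_mem Z hz
  refine (min_le_left _ _).trans ?_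
  have : IsNoetherianRing A := Algebra.FiniteType.isNoetherianRing K A
  have hclosed : IsClosed ((U : Set σ.quotient)ᶜ) := U.isOpen.isClosed_compl
  let C : Set (PrimeSpectrum σ.invariants) := (U : Set σ.quotient)ᶜ
  have hC : PrimeSpectrum.zeroLocus (PrimeSpectrum.vanishingIdeal C) = C := by
    rw [PrimeSpectrum.zeroLocus_vanishingIdeal_eq_closure]
    exact hclosed.closure_eq
  -- A prime containing the extension of the vanishing ideal is a point of X over `C`, where the
  -- depth is at least `i`.
  obtain ⟨rs, hlen, hmem, reg⟩ := exists_isWeaklyRegular_of_forall_localization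
    (PrimeSpectrum.vanishingIdeal C) i A fun q hq hIq ↦ by
      let x : PrimeSpectrum A := ⟨q, hq⟩
      have hx : (x : Spec (CommRingCat.of A)) ∈ σ.quotientMap ⁻¹' (U : Set σ.quotient)ᶜ := by
        change PrimeSpectrum.comap (algebraMap σ.invariants A) ⟨q, hq⟩ ∈ C
        rw [← hC]
        exact Ideal.map_le_iff_le_comap.mp hIq
      have h := hX.le_localRingDepth_of_le_closedCodim
        (hclosed.preimage σ.quotientMap.continuous) hcodim hx
      rw [localRingDepth_stalk_spec x q rfl] at h
      obtain ⟨rs, hlen, hmem, reg⟩ := natCast_le_localRingDepth_iff.mp h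
      exact ⟨rs, hlen, hmem, ((TensorProduct.AlgebraTensorModule.rid A (Localization.AtPrime q)
        (Localization.AtPrime q)).isRegular_congr rs).mpr reg⟩
  have reg' := isWeaklyRegular_of_comap_map_le (σ.comap_map_invariants_le hG) reg
  let z : PrimeSpectrum σ.invariants := Z.isIrreducible.genericPoint
  have hmemz : ∀ r ∈ rs, r ∈ z.asIdeal := fun r hr ↦ by
    have : z ∈ PrimeSpectrum.zeroLocus (PrimeSpectrum.vanishingIdeal C) := hC.symm ▸ hz
    exact this (hmem r hr)
  refine le_of_le_of_eq ?_ (localRingDepth_stalk_spec _ z.asIdeal rfl).symm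
  refine natCast_le_localRingDepth_iff.mpr
    ⟨rs.map (algebraMap _ (Localization.AtPrime z.asIdeal)), by simpa using hlen, ?_,
      reg'.isRegular_of_isLocalization_of_mem _ z.asIdeal hmemz⟩
  intro s hs
  obtain ⟨r, hr, rfl⟩ := List.mem_map.mp hs
  exact (IsLocalization.AtPrime.to_map_mem_maximal_iff _ z.asIdeal r).mpr (hmemz r hr)
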